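/- Let $X$ be a real Banach space with dual $X^*$. For $s>1$ the duality map $J_s^X : X \rightrightarrows X^*$ is $$J_s^X(x)=\{x^*\in X^* : \langle x^*,x\rangle=\|x\|\,\|x^*\|,\ \|x^*\|=\|x\|^{s-1}\},$$ and $j_s^X$ denotes a single-valued selection of $J_s^X$. The space $X$ is called $s$-smooth (smooth of power type $s$) with constant $G_s^X>0$ if $$\|x-y\|^s\le \|x\|^s-s\langle j_s^X(x),y\rangle+G_s^X\|y\|^s\qquad\text{for all }x,y\in X,$$ and $s$-smooth if it is $s$-smooth with some constant. (For $s>1$ this does not depend on the choice of the selection.) **Theorem.** If $X$ is $s$-smooth with constant $G_s^X$, then $X$ is $q$-smooth for every $1<q<s$. Moreover, the constant for $q$-smoothness can be chosen as $$G_q^X=2^{s-q}\max\bigl(2^s,\ G_s^X+K\,2^{s-2}\bigr),$$ where $K$ is the Lipschitz constant of the function $f:[\tfrac12,1]\to\mathbb R$, $h\mapsto h^{q-s}$. -/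

import Mathlib

/-- The set-valued duality map `J_s^X : X ⇉ X^*` with respect to the gauge `h ↦ h ^ (s - 1)`. -/
def dualityMap (X : Type*) [NormedAddCommGroup X] [NormedSpace ℝ X] (s : ℝ) (x : X) :
    Set (StrongDual ℝ X) :=
  {φ | φ x = ‖x‖ * ‖φ‖ ∧ ‖φ‖ = ‖x‖ ^ (s - 1)}

/-- `X` is smooth of power type `s` with constant `G`. Here `j` is a single-valued selection of the
duality map `J_s^X`; for `1 < s` neither its existence nor its choice matters, see
`isSmoothOfPowerTypeWith_iff_forall`. -/
def IsSmoothOfPowerTypeWith (X : Type*) [NormedAddCommGroup X] [NormedSpace ℝ X] (s G : ℝ) :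
    Prop :=
  0 < G ∧ ∃ j : X → StrongDual ℝ X, (∀ x, j x ∈ dualityMap X s x) ∧
    ∀ x y : X, ‖x - y‖ ^ s ≤ ‖x‖ ^ s - s * j x y + G * ‖y‖ ^ s

/-- `X` is smooth of power type `s` (`s`-smooth). -/
def IsSmoothOfPowerType (X : Type*) [NormedAddCommGroup X] [NormedSpace ℝ X] (s : ℝ) : Prop :=
  ∃ G : ℝ, IsSmoothOfPowerTypeWith X s G

/-- The defining inequality holds for one selection of the duality map if and only if it holds for
all its values. -/
theorem isSmoothOfPowerTypeWith_iff_forall (X : Type*) [NormedAddCommGroup X] [NormedSpace ℝ X]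
    {s G : ℝ} (hs : 1 < s) :
    IsSmoothOfPowerTypeWith X s G ↔ 0 < G ∧ ∀ x : X, ∀ φ ∈ dualityMap X s x, ∀ y : X,
      ‖x - y‖ ^ s ≤ ‖x‖ ^ s - s * φ y + G * ‖y‖ ^ s := by
  have hs0 : 0 < s := by linarith
  constructor
  · rintro ⟨hG, j, hj, h⟩
    refine ⟨hG, fun x φ hφ y => ?_⟩
    have sub : ∀ v : X, ‖x‖ ^ s - s * φ v ≤ ‖x - v‖ ^ s := by
      intro v
      obtain ⟨h1, h2⟩ := hφ
      have a1 : φ x - φ v ≤ ‖x‖ ^ (s - 1) * ‖x - v‖ := by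
        rw [← map_sub, ← h2]
        exact (le_abs_self _).trans (φ.le_opNorm _)
      have a2 : φ x = ‖x‖ ^ s := by
        rw [h1, h2]
        rcases eq_or_ne ‖x‖ 0 with h0 | h0
        · rw [h0, Real.zero_rpow hs0.ne', zero_mul]
        · rw [Real.rpow_sub_one h0]; field_simp
      have a3 := Real.young_inequality_of_nonneg (a := ‖x‖ ^ (s - 1)) (b := ‖x - v‖)
        (p := s / (s - 1)) (q := s) (by positivity) (by positivity)
        (Real.HolderConjugate.conjExponent hs).symm
      rw [← Real.rpow_mul (norm_nonneg _),
        mul_div_cancel₀ _ (by linarith : s - 1 ≠ 0)] at a3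
      have a4 : ‖x‖ ^ s / (s / (s - 1)) = ‖x‖ ^ s - ‖x‖ ^ s / s := by
        field_simp
      rw [a4] at a3
      have a5 : ‖x‖ ^ s / s - φ v ≤ ‖x - v‖ ^ s / s := by linarith
      have a6 := mul_le_mul_of_nonneg_left a5 hs0.le
      rwa [mul_sub, mul_div_cancel₀ _ hs0.ne', mul_div_cancel₀ _ hs0.ne'] at a6
    have key : ∀ v : X, j x v - φ v ≤ 0 := by
      intro v
      have b : ∀ t : ℝ, 0 < t → j x v - φ v ≤ G / s * ‖v‖ ^ s * t ^ (s - 1) := by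
        intro t ht
        have c1 := (sub (t • v)).trans (h x (t • v))
        rw [norm_smul, Real.norm_of_nonneg ht.le, Real.mul_rpow ht.le (norm_nonneg _),
          map_smul, map_smul, smul_eq_mul, smul_eq_mul] at c1
        have c2 : t ^ s = t * t ^ (s - 1) := by
          rw [Real.rpow_sub_one ht.ne']; field_simp
        rw [c2] at c1
        have c3 : (s * t) * (j x v - φ v) ≤ (s * t) * (G / s * ‖v‖ ^ s * t ^ (s - 1)) := by
          have : (s * t) * (G / s * ‖v‖ ^ s * t ^ (s - 1))
              = G * (t * t ^ (s - 1) * ‖v‖ ^ s) := by field_simp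
          rw [this]; linarith
        exact le_of_mul_le_mul_left c3 (by positivity)
      have lim : Filter.Tendsto (fun t : ℝ => G / s * ‖v‖ ^ s * t ^ (s - 1))
          (nhdsWithin 0 (Set.Ioi 0)) (nhds 0) := by
        have : Filter.Tendsto (fun t : ℝ => G / s * ‖v‖ ^ s * t ^ (s - 1)) (nhds 0)
            (nhds (G / s * ‖v‖ ^ s * (0 : ℝ) ^ (s - 1))) :=
          ((Real.continuousAt_rpow_const 0 (s - 1) (Or.inr (by linarith))).tendsto).const_mul _
        rw [Real.zero_rpow (by linarith), mul_zero] at this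
        exact this.mono_left nhdsWithin_le_nhds
      exact ge_of_tendsto lim (Filter.eventually_of_mem self_mem_nhdsWithin fun t ht => b t ht)
    have e1 := key y
    have e2 := key (-y)
    rw [map_neg, map_neg] at e2
    have e3 : φ y = j x y := by linarith
    rw [e3]
    exact h x y
  · rintro ⟨hG, h⟩
    have ne : ∀ x : X, ∃ φ, φ ∈ dualityMap X s x := by
      intro x
      rcases eq_or_ne x 0 with rfl | hx
      · exact ⟨0, by simp, by simp [Real.zero_rpow (by linarith : s - 1 ≠ 0)]⟩
      · obtain ⟨g, hg, hgx⟩ := exists_dual_vector ℝ x (norm_ne_zero_iff.mpr hx)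
        have n : ‖‖x‖ ^ (s - 1) • g‖ = ‖x‖ ^ (s - 1) := by
          rw [norm_smul, hg, mul_one, Real.norm_of_nonneg (by positivity)]
        refine ⟨‖x‖ ^ (s - 1) • g, ?_, n⟩
        rw [n]
        simp [hgx, mul_comm]
    choose j hj using ne
    exact ⟨hG, j, hj, fun x y => h x (j x) (hj x) y⟩

/-! For `x ≠ 0` the values of `J_q` and `J_s` at `x` differ by the factor `‖x‖ ^ (s - q)`, so the
`s`-inequality speaks about `φ ∈ J_q x`. If `‖y‖ ≤ 2‖x‖`, weighted AM-GM bounds `‖x‖ ^ (s - q) * ‖x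
- y‖ ^ q` by `s`-th powers, and `‖y‖ ^ s ≤ (2‖x‖) ^ (s - q) * ‖y‖ ^ q` restores the exponent `q`, at
the cost of the constant `2 ^ (s - q) * G`. If `‖y‖ ≥ 2‖x‖`, the triangle inequality and a scalar
estimate in `r = ‖y‖ / ‖x‖` give the constant `2 ^ q` without any smoothness. -/

theorem rpow_sub_smul_mem_dualityMap {X : Type*} [NormedAddCommGroup X] [NormedSpace ℝ X]
    {s q : ℝ} {x : X} (hx : x ≠ 0) {φ : StrongDual ℝ X} (hφ : φ ∈ dualityMap X q x) :
    ‖x‖ ^ (s - q) • φ ∈ dualityMap X s x := by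
  have hN : 0 < ‖x‖ := norm_pos_iff.mpr hx
  obtain ⟨h1, h2⟩ := hφ
  have n : ‖‖x‖ ^ (s - q) • φ‖ = ‖x‖ ^ (s - q) * ‖φ‖ := by
    rw [norm_smul, Real.norm_of_nonneg (by positivity)]
  refine ⟨?_, ?_⟩
  · rw [n, smul_apply, smul_eq_mul, h1]
    ring
  · rw [n, h2, ← Real.rpow_add hN]
    congr 1
    ring

/-- Bernoulli's inequality in homogeneous form. -/
theorem rpow_add_mul_le_rpow_add {a b q : ℝ} (ha : 0 < a) (hb : 0 ≤ b) (hq : 1 ≤ q) :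
    a ^ q + q * a ^ (q - 1) * b ≤ (a + b) ^ q := by
  have h := one_add_mul_self_le_rpow_one_add (s := b / a) (by linarith [div_nonneg hb ha.le]) hq
  have e : a + b = a * (1 + b / a) := by field_simp
  rw [e, Real.mul_rpow ha.le (by positivity)]
  refine le_trans (le_of_eq ?_) (mul_le_mul_of_nonneg_left h (Real.rpow_nonneg ha.le q))
  rw [Real.rpow_sub_one ha.ne']
  field_simp

/-- Bernoulli applied to the splitting `2 * r = (1 + r) + (r - 1)`. -/
theorem one_add_rpow_add_mul_sub_one_le {r q : ℝ} (hr : 2 ≤ r) (hq : 1 ≤ q) :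
    (1 + r) ^ q + q * r - 1 ≤ 2 ^ q * r ^ q := by
  have h1 := rpow_add_mul_le_rpow_add (a := 1 + r) (b := r - 1) (by linarith) (by linarith) hq
  rw [show 1 + r + (r - 1) = 2 * r by ring, Real.mul_rpow (by norm_num) (by linarith)] at h1
  -- Here `r ≥ 2` enters through `1 + r ≥ 3 > e`.
  have h2 : q ≤ (1 + r) ^ (q - 1) :=
    calc q ≤ Real.exp (q - 1) := by linarith [Real.add_one_le_exp (q - 1)]
      _ = Real.exp 1 ^ (q - 1) := (Real.exp_one_rpow _).symm
      _ ≤ (1 + r) ^ (q - 1) := Real.rpow_le_rpow (Real.exp_pos 1).le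
          (by linarith [Real.exp_one_lt_d9]) (by linarith)
  have h3 : q * q * (r - 1) ≤ q * (1 + r) ^ (q - 1) * (r - 1) := by
    have : 0 ≤ r - 1 := by linarith
    gcongr
  -- The difference of the two sides is `q * (q - 1) * (r - 2) + (q - 1) ^ 2`.
  have h4 : q * r - 1 ≤ q * q * (r - 1) := by
    nlinarith [mul_nonneg (mul_nonneg (by linarith : 0 ≤ q) (sub_nonneg.2 hq)) (sub_nonneg.2 hr),
      sq_nonneg (q - 1)]
  linarith

theorem norm_sub_rpow_le_of_two_mul_norm_le {X : Type*} [NormedAddCommGroup X] [NormedSpace ℝ X]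
    {q : ℝ} (hq : 1 < q) {x y : X} (hx : x ≠ 0) (hxy : 2 * ‖x‖ ≤ ‖y‖) {φ : StrongDual ℝ X}
    (hφ : φ ∈ dualityMap X q x) :
    ‖x - y‖ ^ q ≤ ‖x‖ ^ q - q * φ y + 2 ^ q * ‖y‖ ^ q := by
  have hN : 0 < ‖x‖ := norm_pos_iff.mpr hx
  have hφy : φ y ≤ ‖x‖ ^ (q - 1) * ‖y‖ := by
    rw [← hφ.2]
    exact (le_abs_self _).trans (φ.le_opNorm y)
  have hd : ‖x - y‖ ^ q ≤ (‖x‖ + ‖y‖) ^ q :=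
    Real.rpow_le_rpow (norm_nonneg _) (norm_sub_le x y) (by linarith)
  have h := mul_le_mul_of_nonneg_left
    (one_add_rpow_add_mul_sub_one_le (r := ‖y‖ / ‖x‖) ((le_div_iff₀ hN).2 hxy) hq.le)
    (Real.rpow_nonneg hN.le q)
  have e1 : ‖x‖ ^ q * (1 + ‖y‖ / ‖x‖) ^ q = (‖x‖ + ‖y‖) ^ q := by
    rw [← Real.mul_rpow hN.le (by positivity)]
    congr 1
    field_simp
  have e2 : ‖x‖ ^ q * (‖y‖ / ‖x‖) ^ q = ‖y‖ ^ q := by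
    rw [← Real.mul_rpow hN.le (by positivity)]
    congr 1
    field_simp
  have e3 : ‖x‖ ^ q * (q * (‖y‖ / ‖x‖)) = q * (‖x‖ ^ (q - 1) * ‖y‖) := by
    rw [Real.rpow_sub_one hN.ne']
    field_simp
  have h' : (‖x‖ + ‖y‖) ^ q + q * (‖x‖ ^ (q - 1) * ‖y‖) - ‖x‖ ^ q ≤ 2 ^ q * ‖y‖ ^ q := by
    rw [← e1, ← e2, ← e3]
    linarith
  have := mul_le_mul_of_nonneg_left hφy (by linarith : 0 ≤ q)
  linarith

theorem IsSmoothOfPowerTypeWith.norm_sub_rpow_le_of_norm_le_two_mul {X : Type*}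
    [NormedAddCommGroup X] [NormedSpace ℝ X] {s q G : ℝ} (hX : IsSmoothOfPowerTypeWith X s G)
    (hq : 1 < q) (hqs : q < s) {x y : X} (hx : x ≠ 0) (hxy : ‖y‖ ≤ 2 * ‖x‖)
    {φ : StrongDual ℝ X} (hφ : φ ∈ dualityMap X q x) :
    ‖x - y‖ ^ q ≤ ‖x‖ ^ q - q * φ y + 2 ^ (s - q) * G * ‖y‖ ^ q := by
  have hs : 0 < s := by linarith
  have hN : 0 < ‖x‖ := norm_pos_iff.mpr hx
  obtain ⟨hG, hall⟩ := (isSmoothOfPowerTypeWith_iff_forall X (hq.trans hqs)).1 hX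
  have h := hall x _ (rpow_sub_smul_mem_dualityMap hx hφ) y
  rw [smul_apply, smul_eq_mul] at h
  -- These weights turn the geometric mean into `‖x - y‖ ^ q * ‖x‖ ^ (s - q)`.
  have hy := Real.geom_mean_le_arith_mean2_weighted (w₁ := q / s) (w₂ := (s - q) / s)
    (p₁ := ‖x - y‖ ^ s) (p₂ := ‖x‖ ^ s) (by positivity)
    (div_nonneg (by linarith) hs.le) (by positivity) (by positivity) (by field_simp; ring)
  rw [← Real.rpow_mul (norm_nonneg _), ← Real.rpow_mul (norm_nonneg _),
    mul_div_cancel₀ _ hs.ne', mul_div_cancel₀ _ hs.ne'] at hy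
  have hr : ‖y‖ ^ s ≤ 2 ^ (s - q) * ‖x‖ ^ (s - q) * ‖y‖ ^ q := by
    rw [← Real.mul_rpow (by norm_num) hN.le]
    calc ‖y‖ ^ s = ‖y‖ ^ (s - q) * ‖y‖ ^ q := by
          rw [← Real.rpow_add_of_nonneg (norm_nonneg _) (by linarith) (by linarith)]
          congr 1
          ring
      _ ≤ _ := by
          gcongr
  have hNs : ‖x‖ ^ s = ‖x‖ ^ (s - q) * ‖x‖ ^ q := by
    rw [← Real.rpow_add hN]
    congr 1
    ring
  have hGr : q / s * (G * ‖y‖ ^ s) ≤ G * (2 ^ (s - q) * ‖x‖ ^ (s - q) * ‖y‖ ^ q) :=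
    calc q / s * (G * ‖y‖ ^ s) ≤ 1 * (G * ‖y‖ ^ s) := by
          gcongr
          exact (div_le_one hs).2 hqs.le
      _ ≤ _ := by
          rw [one_mul]
          gcongr
  have hq' := mul_le_mul_of_nonneg_left h (by positivity : 0 ≤ q / s)
  have e : q / s * (‖x‖ ^ s - s * (‖x‖ ^ (s - q) * φ y) + G * ‖y‖ ^ s)
      + (s - q) / s * ‖x‖ ^ s
      = ‖x‖ ^ s - q * (‖x‖ ^ (s - q) * φ y) + q / s * (G * ‖y‖ ^ s) := by
    field_simp
    ring
  refine le_of_mul_le_mul_left (a := ‖x‖ ^ (s - q)) ?_ (by positivity)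
  linarith

theorem IsSmoothOfPowerTypeWith.of_lt {X : Type*} [NormedAddCommGroup X] [NormedSpace ℝ X]
    {s q G C : ℝ} (hX : IsSmoothOfPowerTypeWith X s G) (hq : 1 < q) (hqs : q < s)
    (hC : 2 ^ (s - q) * max (2 ^ s) G ≤ C) : IsSmoothOfPowerTypeWith X q C := by
  have h2 : (1 : ℝ) ≤ 2 ^ (s - q) := Real.one_le_rpow (by norm_num) (by linarith)
  have hqC : (2 : ℝ) ^ q ≤ C :=
    calc (2 : ℝ) ^ q ≤ 2 ^ s := Real.rpow_le_rpow_of_exponent_le (by norm_num) hqs.le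
      _ ≤ max (2 ^ s) G := le_max_left _ _
      _ ≤ 2 ^ (s - q) * max (2 ^ s) G := le_mul_of_one_le_left (by positivity) h2
      _ ≤ C := hC
  have hGC : 2 ^ (s - q) * G ≤ C :=
    (mul_le_mul_of_nonneg_left (le_max_right _ _) (by positivity)).trans hC
  have h1C : 1 ≤ C := (Real.one_le_rpow (by norm_num) (by linarith)).trans hqC
  refine (isSmoothOfPowerTypeWith_iff_forall X hq).2 ⟨by linarith, fun x φ hφ y => ?_⟩
  have hyq : 0 ≤ ‖y‖ ^ q := by positivity
  rcases eq_or_ne x 0 with rfl | hx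
  -- At `x = 0` the claim reduces to `1 ≤ C`.
  · have hφ0 : φ = 0 := by
      rw [← norm_eq_zero, hφ.2, norm_zero, Real.zero_rpow (by linarith)]
    rw [hφ0, zero_sub, norm_neg, norm_zero, Real.zero_rpow (by linarith)]
    simpa using mul_le_mul_of_nonneg_right h1C hyq
  · rcases le_total ‖y‖ (2 * ‖x‖) with h | h
    · have := hX.norm_sub_rpow_le_of_norm_le_two_mul hq hqs hx h hφ
      linarith [mul_le_mul_of_nonneg_right hGC hyq]
    · have := norm_sub_rpow_le_of_two_mul_norm_le hq hx h hφ
      linarith [mul_le_mul_of_nonneg_right hqC hyq]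

theorem mainTheorem4 (X : Type*) [NormedAddCommGroup X] [NormedSpace ℝ X] [CompleteSpace X]
    (s G : ℝ) (hX : IsSmoothOfPowerTypeWith X s G) (q : ℝ) (hq : 1 < q) (hqs : q < s) :
    IsSmoothOfPowerType X q ∧
      ∀ K : NNReal, LipschitzOnWith K (fun h : ℝ => h ^ (q - s)) (Set.Icc (1 / 2) 1) →
        IsSmoothOfPowerTypeWith X q
          ((2 : ℝ) ^ (s - q) * max ((2 : ℝ) ^ s) (G + K * (2 : ℝ) ^ (s - 2))) := by
  refine ⟨⟨_, hX.of_lt hq hqs le_rfl⟩, fun K _ => hX.of_lt hq hqs ?_⟩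
  -- The constant `2 ^ (s - q) * max (2 ^ s) G` already works; the `K` term only enlarges it.
  have : 0 ≤ (K : ℝ) * 2 ^ (s - 2) := by positivity
  gcongr
  linarith
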